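/- For a complex Banach space $X$ let $B_X$ be its open unit ball, $\mathcal H^\infty(B_X)$ the Banach algebra of bounded holomorphic functions on $B_X$ with the sup norm, and $\mathcal M_\infty(B_X)$ the set of nonzero algebra homomorphisms $\varphi:\mathcal H^\infty(B_X)\to\mathbb C$ (these are automatically continuous). Let $\pi:\mathcal M_\infty(B_X)\to\overline B_{X^{**}}$, $\pi(\varphi)=\varphi|_{X^*}$. The Gleason metric on $\mathcal M_\infty(B_X)$ is $\|\varphi-\psi\|$, the norm of $\mathcal H^\infty(B_X)^*$, and the Gleason part of $\varphi$ is $\{\psi:\|\varphi-\psi\|<2\}$; the Gleason parts partition $\mathcal M_\infty(B_X)$. The Gleason metric on $B_{\ell_\infty}$ is $\|\delta_w-\delta_v\|$, where $\delta_w\in\mathcal M_\infty(B_{\ell_\infty})$ is evaluation at $w$. A map $F:B_{\ell_\infty}\to\mathcal M_\infty(B_{c_0})$ is analytic if $w\mapsto F(w)(f)$ is holomorphic on $B_{\ell_\infty}$ for every $f\in\mathcal H^\infty(B_{c_0})$, and a Gleason isometry if $\|F(w)-F(v)\|=\|\delta_w-\delta_v\|$ for all $w,v\in B_{\ell_\infty}$.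 **Theorem 1.1.** For every $z\in\overline B_{\ell_\infty}$ (where $\ell_\infty=(c_0)^{**}$) there is a map $$\Phi_z:(\beta(\mathbb N)\setminus\mathbb N)\times B_{\ell_\infty}\to\pi^{-1}(z)\subset\mathcal M_\infty(B_{c_0})$$ such that: 1. for every $\eta\in\beta(\mathbb N)\setminus\mathbb N$ the map $\Phi_z^\eta:B_{\ell_\infty}\to\pi^{-1}(z)$, $\Phi_z^\eta(w)=\Phi_z(\eta,w)$, is an analytic Gleason isometry; 2. if $\eta_1\neq\eta_2$ in $\beta(\mathbb N)\setminus\mathbb N$, then $\Phi_z^{\eta_1}(B_{\ell_\infty})$ and $\Phi_z^{\eta_2}(B_{\ell_\infty})$ lie in different Gleason parts, that is, each of these images is contained in a single Gleason part and these two parts are disjoint. Consequently the images $\Phi_z^\eta(B_{\ell_\infty})$ form a family of exactly $2^{\mathfrak c}$ pairwise disjoint analytic Gleason isometric copies of $B_{\ell_\infty}$ inside the fiber $\pi^{-1}(z)$, where $\mathfrak c$ is the cardinality of the continuum. -/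

import Mathlib

open Metric Set
open scoped ZeroAtInfty BoundedContinuousFunction

noncomputable section

/-- The complex Banach space `c₀` of null sequences, with the sup norm. -/
abbrev CZero : Type := C₀(ℕ, ℂ)

/-- The complex Banach space `ℓ_∞` of bounded sequences, with the sup norm. -/
abbrev EllInfty : Type := lp (fun _ : ℕ => ℂ) ⊤

/-- The open unit ball of a complex normed space. -/
abbrev UnitBall (E : Type*) [NormedAddCommGroup E] : Type _ := ball (0 : E) 1

section Holomorphic

variable (E : Type*) [NormedAddCommGroup E] [NormedSpace ℂ E]

/-- A function on the open unit ball is holomorphic if it is (complex Fréchet) differentiable at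
every point of the ball; the auxiliary `F` is any extension of `f` by arbitrary values outside. -/
def IsHolomorphicOnBall {E : Type*} [NormedAddCommGroup E] [NormedSpace ℂ E]
    (f : UnitBall E → ℂ) : Prop :=
  ∃ F : E → ℂ, DifferentiableOn ℂ F (ball 0 1) ∧ ∀ x : UnitBall E, F x = f x

/-- The uniform algebra `H^∞(B_E)` of bounded holomorphic functions on the open unit ball of `E`,
with the sup norm. -/
def HInfty : Subalgebra ℂ (UnitBall E →ᵇ ℂ) where
  carrier := {f | IsHolomorphicOnBall f}
  mul_mem' := by
    rintro f g ⟨F, hF, hFf⟩ ⟨G, hG, hGg⟩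
    exact ⟨fun x => F x * G x, hF.mul hG, fun x => by simp [hFf, hGg]⟩
  add_mem' := by
    rintro f g ⟨F, hF, hFf⟩ ⟨G, hG, hGg⟩
    exact ⟨fun x => F x + G x, hF.add hG, fun x => by simp [hFf, hGg]⟩
  algebraMap_mem' c :=
    ⟨fun _ => c, differentiableOn_const c, fun x => by
      simp [BoundedContinuousFunction.algebraMap_apply]⟩

/-- The spectrum `M_∞(B_E)`: the nonzero (automatically continuous) algebra homomorphisms from
`H^∞(B_E)` to `ℂ`. -/
abbrev MInfty : Type _ := WeakDual.characterSpace ℂ (HInfty E)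

variable {E}

/-- The Gleason metric `‖φ - ψ‖` on the spectrum (norm of the dual of `H^∞(B_E)`). -/
def gleasonDist (φ ψ : MInfty E) : ℝ :=
  ‖WeakDual.toStrongDual (φ : WeakDual ℂ (HInfty E)) -
    WeakDual.toStrongDual (ψ : WeakDual ℂ (HInfty E))‖

/-- The Gleason part of `φ`. -/
def gleasonPart (φ : MInfty E) : Set (MInfty E) := {ψ | gleasonDist φ ψ < 2}

/-- The evaluation homomorphism `f ↦ f x` at a point of the open unit ball. -/
def evalHom (x : UnitBall E) : MInfty E :=
  ⟨StrongDual.toWeakDual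
      ((BoundedContinuousFunction.evalCLM ℂ x).comp (HInfty E).toSubmodule.subtypeL), by
    constructor
    · intro h
      have h1 := congrArg (fun φ : WeakDual ℂ (HInfty E) => φ 1) h
      exact one_ne_zero (α := ℂ) h1
    · intro f g
      rfl⟩

/-- The restriction to the unit ball of a continuous linear functional, as a bounded holomorphic
function. -/
def restrictDual : StrongDual ℂ E →L[ℂ] HInfty E :=
  LinearMap.mkContinuous
    { toFun := fun l =>
        ⟨BoundedContinuousFunction.ofNormedAddCommGroup (fun x : UnitBall E => l x)
            (l.continuous.comp continuous_subtype_val) ‖l‖ (fun x =>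
              (l.le_opNorm x).trans (mul_le_of_le_one_right (norm_nonneg l)
                (mem_ball_zero_iff.1 x.2).le)),
          l, l.differentiable.differentiableOn, fun _ => rfl⟩
      map_add' := fun _ _ => rfl
      map_smul' := fun _ _ => rfl }
    1 (fun l => by
      rw [one_mul]
      exact (BoundedContinuousFunction.norm_le (norm_nonneg l)).2 fun x =>
        (l.le_opNorm x).trans (mul_le_of_le_one_right (norm_nonneg l)
          (mem_ball_zero_iff.1 x.2).le))

/-- The projection `π(φ) = φ|_{E*}` of the spectrum into the bidual `E**`. -/
def spectrumProj (φ : MInfty E) : StrongDual ℂ (StrongDual ℂ E) :=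
  (WeakDual.toStrongDual (φ : WeakDual ℂ (HInfty E))).comp restrictDual

/-- A map from the unit ball of `V` into the spectrum is analytic if its composition with (the
Gelfand transform of) every `f ∈ H^∞(B_E)` is holomorphic. -/
def IsAnalyticIntoSpectrum {V : Type*} [NormedAddCommGroup V] [NormedSpace ℂ V]
    (F : UnitBall V → MInfty E) : Prop :=
  ∀ f : HInfty E, IsHolomorphicOnBall (fun w => F w f)

/-- A Gleason isometry from the unit ball of `V` into the spectrum `M_∞(B_E)`. On the ball of `V`
the Gleason metric is `‖δ_w - δ_v‖`, where `δ_w` is the evaluation at `w` on `H^∞(B_V)`. -/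
def IsGleasonIsometry {V : Type*} [NormedAddCommGroup V] [NormedSpace ℂ V]
    (F : UnitBall V → MInfty E) : Prop :=
  ∀ w v : UnitBall V, gleasonDist (F w) (F v) = gleasonDist (evalHom w) (evalHom v)

/-- Two sets lie in different Gleason parts: each is contained in one part, and these two parts
are disjoint. -/
def LieInDifferentGleasonParts (S T : Set (MInfty E)) : Prop :=
  ∃ φ ψ : MInfty E, S ⊆ gleasonPart φ ∧ T ⊆ gleasonPart ψ ∧
    Disjoint (gleasonPart φ) (gleasonPart ψ)

end Holomorphic

/-- The canonical unit vector `e_n` of `c₀`. -/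
def unitVec (n : ℕ) : CZero where
  toFun := Pi.single n 1
  continuous_toFun := continuous_of_discreteTopology
  zero_at_infty' := by
    refine tendsto_const_nhds.congr' ?_
    rw [Filter.EventuallyEq, Filter.cocompact_eq_cofinite, Filter.eventually_cofinite]
    refine (Set.finite_singleton n).subset fun m hm => ?_
    by_contra h
    exact hm (by simp [Pi.single_eq_of_ne (show m ≠ n from h)])

/-- The fiber `π⁻¹(z) ⊆ M_∞(B_{c₀})` over `z ∈ ℓ_∞ = (c₀)**`; here `z` acts on `l ∈ (c₀)* = ℓ₁`
by `∑ n, z_n l(e_n)`. -/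
def fiber (z : EllInfty) : Set (MInfty CZero) :=
  {φ | ∀ l : StrongDual ℂ CZero, HasSum (fun n => z n * l (unitVec n)) (spectrumProj φ l)}

/-- The remainder `β(ℕ) ∖ ℕ` of the Stone–Čech compactification of `ℕ`. -/
abbrev BetaRemainder : Type := {η : StoneCech ℕ // η ∉ Set.range (stoneCechUnit : ℕ → StoneCech ℕ)}

end

/-!
For `η ∈ β(ℕ) ∖ ℕ` and `w` in the ball of `ℓ_∞`, the character `Φ_z(η, w)` is the limit, as `n → η`,
of the evaluations at the points
`x_n(w) = (s_n z₀, …, s_n z_{n-1}, p_n, w₀, …, w_{n-1}, 0, …)` of the ball of `c₀`, where `s_n → 1`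
and the marker `p_n` tends very fast to the unit circle, in a direction opposite to `z_n`. These
points converge weak-* to `z`, so the limits lie in the fiber over `z` (`fiberMap_mem_fiber`). Since
bounded pointwise limits of holomorphic functions are holomorphic
(`differentiableOn_ball_of_tendsto`), `f ↦ Φ_z(η, ·)(f)` is a contraction from `H^∞(B_{c₀})` to
`H^∞(B_{ℓ_∞})`. This gives analyticity and one half of the isometry.

The markers make it possible to recognize `n` from `x_n(w)` by functions of norm almost one. A
conformal map onto a thin neighbourhood of `[0, 1]` (`exists_peaking`) gives functions `H_k` of the
`k`-th coordinate with `|H_k| + |1 - H_k| ≤ 1 + 2⁻ᵏ`, close to `1` at the marker `p_k` and close to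
`0` at the multiples `s z_k`, `0 ≤ s < 1`. Then `F_k = H_k ∏_{K ≤ j < k} (1 - H_j)`, `k ≥ K`,
satisfy `∑ |F_k| ≤ 1 + ε` on the whole ball and `F_n(x_n(w)) ≈ 1`. So for any holomorphic `g_k`
bounded by `1` some `f` in the unit ball of `H^∞(B_{c₀})` has `f(x_n(w)) ≈ g_n(x_n(w))` for all
`n ≥ K` (`exists_interpolating`).

* With `g_k = ±1` according to a set `A ⊆ ℕ` that separates `η₁` from `η₂`, the two images are almost
  separated by `1` and `-1`, and the Möbius argument of `two_le_gleasonDist_of_re_nonpos` shows that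
  no character is at Gleason distance `< 2` from both of them.
* With `g_k` a function of finitely many coordinates after the `k`-th one, `Φ_z(η, w)(f)` is close to
  the value of a given function at `w`; such functions compute the Gleason metric of `B_{ℓ_∞}`, as two
  bounded sequences are uniformly close to sequences repeating finitely many of their entries
  (`exists_selector`). This is the other half of the isometry.

Each image lies in one part by the Schwarz lemma, and there are `2^𝔠` of them because `β(ℕ)` maps
onto the separable cube `{0, 1}^(2^ℕ)`.
-/

open Filter Topology

noncomputable section

/-! ### Bounded pointwise limits of holomorphic functions -/

section BoundedHolomorphic

variable {E : Type*} [NormedAddCommGroup E] [NormedSpace ℂ E]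

/-- First-order Taylor estimate for a bounded holomorphic function, with constants independent of
the function: the Schwarz lemma, applied once to the derivative and once to the remainder. -/
lemma norm_taylor_remainder_le {f : E → ℂ} {x y : E} {R C : ℝ}
    (hd : DifferentiableOn ℂ f (ball x R)) (hb : ∀ y ∈ ball x R, ‖f y‖ ≤ C) (hy : y ∈ ball x R) :
    ‖fderiv ℂ f x‖ ≤ 2 * C / R ∧
      ‖f y - f x - fderiv ℂ f x (y - x)‖ ≤ 4 * C / R ^ 2 * ‖y - x‖ ^ 2 := by
  have hR : 0 < R := nonempty_ball.mp ⟨_, hy⟩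
  have hx : x ∈ ball x R := mem_ball_self hR
  have hosc : ∀ y ∈ ball x R, ‖f y - f x‖ ≤ 2 * C := fun y hy => by
    linarith [norm_sub_le (f y) (f x), hb y hy, hb x hx]
  have hL : ‖fderiv ℂ f x‖ ≤ 2 * C / R :=
    Complex.norm_fderiv_le_div_of_mapsTo_ball hd
      (fun y hy => by simpa [dist_eq_norm] using hosc y hy) hR
  have hdx : HasFDerivAt f (fderiv ℂ f x) x :=
    (hd.differentiableAt (ball_mem_nhds x hR)).hasFDerivAt
  refine ⟨hL, ?_⟩
  have key := Complex.dist_le_mul_div_pow_of_mapsTo_ball_of_isLittleO (n := 1) (R₂ := 4 * C)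
    (f := fun y => f y - fderiv ℂ f x (y - x)) (c := x) (z := y) (R₁ := R)
    (hd.sub (by fun_prop)) ?_ ?_ hy
  · refine (le_of_eq ?_).trans (key.trans_eq ?_)
    · simp only [dist_eq_norm, sub_self, map_zero, sub_zero]
      congr 1
      ring
    · rw [dist_eq_norm, div_pow]
      ring
  · intro w hw
    have h1 : ‖fderiv ℂ f x (w - x)‖ ≤ 2 * C := by
      have hw' : ‖w - x‖ ≤ R := by simpa [dist_eq_norm] using (mem_ball.mp hw).le
      calc ‖fderiv ℂ f x (w - x)‖ ≤ 2 * C / R * R :=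
            (ContinuousLinearMap.le_opNorm _ _).trans
              (mul_le_mul hL hw' (norm_nonneg _) ((norm_nonneg _).trans hL))
        _ = 2 * C := by field_simp
    rw [mem_closedBall, dist_eq_norm]
    simp only [sub_self, map_zero, sub_zero]
    calc ‖f w - fderiv ℂ f x (w - x) - f x‖ = ‖(f w - f x) - fderiv ℂ f x (w - x)‖ := by
          congr 1; ring
      _ ≤ 4 * C := by linarith [norm_sub_le (f w - f x) (fderiv ℂ f x (w - x)), hosc w hw]
  · have := hdx.isLittleO
    refine (this.congr_left fun w => ?_).trans_isBigO ?_
    · simp only [sub_self, map_zero, sub_zero]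
      ring
    · simpa using (Asymptotics.isBigO_refl (fun w => w - x) (𝓝 x)).norm_right

/-- A pointwise limit, along any filter, of uniformly bounded holomorphic functions on the unit
ball is holomorphic. The derivative of the limit is a weak-* cluster point of the derivatives,
which exists by the Banach–Alaoglu theorem. -/
lemma differentiableOn_ball_of_tendsto {ι : Type*} {l : Filter ι} [l.NeBot] {F : ι → E → ℂ}
    {G : E → ℂ} {C : ℝ} (hd : ∀ i, DifferentiableOn ℂ (F i) (ball 0 1))
    (hb : ∀ i, ∀ x ∈ ball (0 : E) 1, ‖F i x‖ ≤ C)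
    (hlim : ∀ x ∈ ball (0 : E) 1, Tendsto (fun i => F i x) l (𝓝 (G x))) :
    DifferentiableOn ℂ G (ball 0 1) := by
  intro x hx
  refine DifferentiableAt.differentiableWithinAt ?_
  have hR : 0 < 1 - ‖x‖ := by simpa using hx
  set R := 1 - ‖x‖
  have hsub : ball x R ⊆ ball (0 : E) 1 := ball_subset_ball' (by simp [R])
  have taylor := fun i (y : E) (hy : y ∈ ball x R) =>
    norm_taylor_remainder_le ((hd i).mono hsub) (fun y hy => hb i y (hsub hy)) hy
  let u : Ultrafilter ι := Ultrafilter.of l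
  have hu : (u : Filter ι) ≤ l := Ultrafilter.of_le l
  have hcomp := WeakDual.isCompact_closedBall (𝕜 := ℂ) (0 : StrongDual ℂ E) (2 * C / R)
  obtain ⟨L, -, hL⟩ := hcomp.ultrafilter_le_nhds
    (u.map fun i => StrongDual.toWeakDual (fderiv ℂ (F i) x)) (by
      refine le_principal_iff.mpr (Filter.mem_map.mpr (Filter.univ_mem' fun i => ?_))
      simpa using (taylor i x (mem_ball_self hR)).1)
  have hLlim : ∀ h : E, Tendsto (fun i => fderiv ℂ (F i) x h) u (𝓝 (L h)) := fun h =>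
    ((WeakDual.eval_continuous h).tendsto L).comp hL
  have hder : HasFDerivAt G (WeakDual.toStrongDual L) x := by
    refine HasFDerivAt.of_isLittleO ?_
    have hbig : (fun y => G y - G x - WeakDual.toStrongDual L (y - x)) =O[𝓝 x]
        fun y => ‖y - x‖ ^ 2 := by
      refine Asymptotics.IsBigO.of_bound (4 * C / R ^ 2) ?_
      filter_upwards [ball_mem_nhds x hR] with y hy
      rw [norm_pow, norm_norm]
      refine le_of_tendsto (f := fun i => ‖F i y - F i x - fderiv ℂ (F i) x (y - x)‖) (x := u)
        ?_ (Eventually.of_forall fun i => (taylor i y hy).2)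
      exact ((((hlim y (hsub hy)).mono_left hu).sub ((hlim x hx).mono_left hu)).sub
        (hLlim (y - x))).norm
    exact hbig.trans_isLittleO (Asymptotics.isLittleO_pow_sub_sub x one_lt_two)
  exact hder.differentiableAt

/-- The element of `H^∞(B_E)` given by a function on `E` which is holomorphic and bounded on the
unit ball. -/
def HInfty.mk (F : E → ℂ) (hF : DifferentiableOn ℂ F (ball 0 1)) (C : ℝ)
    (hC : ∀ x ∈ ball (0 : E) 1, ‖F x‖ ≤ C) : HInfty E :=
  ⟨BoundedContinuousFunction.ofNormedAddCommGroup (fun x : UnitBall E => F x)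
    (continuousOn_iff_continuous_domRestrict.mp hF.continuousOn) C (fun x => hC x x.2),
    F, hF, fun _ => rfl⟩

lemma HInfty.mk_apply {F : E → ℂ} {hF : DifferentiableOn ℂ F (ball 0 1)} {C : ℝ}
    {hC : ∀ x ∈ ball (0 : E) 1, ‖F x‖ ≤ C} (x : UnitBall E) :
    (HInfty.mk F hF C hC : UnitBall E →ᵇ ℂ) x = F x := rfl

lemma HInfty.norm_mk_le {F : E → ℂ} {hF : DifferentiableOn ℂ F (ball 0 1)} {C : ℝ}
    {hC : ∀ x ∈ ball (0 : E) 1, ‖F x‖ ≤ C} (h0 : 0 ≤ C) : ‖HInfty.mk F hF C hC‖ ≤ C :=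
  (BoundedContinuousFunction.norm_le h0).mpr fun x => hC x x.2

lemma HInfty.norm_apply_le (f : HInfty E) (x : UnitBall E) :
    ‖(f : UnitBall E →ᵇ ℂ) x‖ ≤ ‖f‖ :=
  BoundedContinuousFunction.norm_coe_le_norm (f : UnitBall E →ᵇ ℂ) x

lemma HInfty.exists_extension (f : HInfty E) : ∃ F : E → ℂ, DifferentiableOn ℂ F (ball 0 1) ∧
    (∀ x : UnitBall E, F x = (f : UnitBall E →ᵇ ℂ) x) ∧ ∀ x ∈ ball (0 : E) 1, ‖F x‖ ≤ ‖f‖ := by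
  obtain ⟨F, hF, hFf⟩ := f.2
  exact ⟨F, hF, hFf, fun x hx => (hFf ⟨x, hx⟩).symm ▸ HInfty.norm_apply_le f ⟨x, hx⟩⟩

/-- `H^∞(B_E)` is complete, so that its spectrum is weak-* compact. -/
instance HInfty.instCompleteSpace : CompleteSpace (HInfty E) := by
  refine IsClosed.completeSpace_coe (hs := isClosed_of_closure_subset fun f hf => ?_)
  obtain ⟨s, hs, hlim⟩ := mem_closure_iff_seq_limit.mp hf
  choose F hF hFs using hs
  obtain ⟨C, hC⟩ := (Metric.isBounded_range_of_tendsto s hlim).exists_norm_le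
  classical
  refine ⟨fun x => if hx : x ∈ ball 0 1 then f ⟨x, hx⟩ else 0,
    differentiableOn_ball_of_tendsto (l := atTop) (C := C) hF (fun n x hx => ?_)
      (fun x hx => ?_), fun x => by simp⟩
  · rw [hFs n ⟨x, hx⟩]
    exact ((s n).norm_coe_le_norm _).trans (hC _ (mem_range_self n))
  · simp only [hx, dif_pos, hFs _ ⟨x, hx⟩]
    exact ((BoundedContinuousFunction.evalCLM ℂ ⟨x, hx⟩).continuous.tendsto f).comp hlim

end BoundedHolomorphic

/-! ### The Gleason metric -/

section Gleason

variable {E : Type*} [NormedAddCommGroup E] [NormedSpace ℂ E]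

lemma norm_sub_le_gleasonDist (φ ψ : MInfty E) (f : HInfty E) :
    ‖φ f - ψ f‖ ≤ gleasonDist φ ψ * ‖f‖ :=
  ContinuousLinearMap.le_opNorm (WeakDual.toStrongDual (φ : WeakDual ℂ (HInfty E)) -
    WeakDual.toStrongDual (ψ : WeakDual ℂ (HInfty E))) f

lemma gleasonDist_nonneg (φ ψ : MInfty E) : 0 ≤ gleasonDist φ ψ :=
  norm_nonneg (WeakDual.toStrongDual (φ : WeakDual ℂ (HInfty E)) -
    WeakDual.toStrongDual (ψ : WeakDual ℂ (HInfty E)))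

lemma gleasonDist_le {φ ψ : MInfty E} {C : ℝ} (hC : 0 ≤ C)
    (h : ∀ f : HInfty E, ‖φ f - ψ f‖ ≤ C * ‖f‖) : gleasonDist φ ψ ≤ C :=
  ContinuousLinearMap.opNorm_le_bound _ hC h

lemma evalHom_apply (x : UnitBall E) (f : HInfty E) :
    evalHom x f = (f : UnitBall E →ᵇ ℂ) x := rfl

/-- The unit ball lies in a single Gleason part, by the Schwarz lemma. -/
lemma gleasonDist_evalHom_zero_lt_two (w : UnitBall E) :
    gleasonDist (evalHom ⟨0, mem_ball_self one_pos⟩) (evalHom w) < 2 := by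
  have hw : ‖(w : E)‖ < 1 := mem_ball_zero_iff.mp w.2
  refine lt_of_le_of_lt (gleasonDist_le (C := 2 * ‖(w : E)‖) (by positivity) fun f => ?_)
    (by linarith)
  obtain ⟨F, hF, hFf, hb⟩ := HInfty.exists_extension f
  have h0 : (0 : E) ∈ ball (0 : E) 1 := mem_ball_self one_pos
  have := Complex.dist_le_div_mul_dist_of_mapsTo_ball (R₂ := 2 * ‖f‖) hF
    (fun x hx => by
      rw [mem_closedBall, dist_eq_norm]
      linarith [norm_sub_le (F x) (F 0), hb x hx, hb 0 h0]) w.2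
  rw [evalHom_apply, evalHom_apply, ← hFf w, ← hFf ⟨0, h0⟩, norm_sub_rev]
  rw [dist_eq_norm, dist_zero_right, div_one] at this
  exact this.trans_eq (by ring)

/-- For `0 < c < 1` and `‖f‖ ≤ 1`, the Möbius transform `(f - c) / (1 - c f)` is again in the
unit ball of `H^∞(B_E)`. -/
lemma HInfty.exists_moebius (f : HInfty E) (hf : ‖f‖ ≤ 1) {c : ℝ} (hc0 : 0 < c) (hc1 : c < 1) :
    ∃ g : HInfty E, ‖g‖ ≤ 1 ∧ g * (1 - (c : ℂ) • f) = f - (c : ℂ) • 1 := by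
  obtain ⟨F, hF, hFf, hb⟩ := HInfty.exists_extension f
  have hb' : ∀ x ∈ ball (0 : E) 1, ‖F x‖ ≤ 1 := fun x hx => (hb x hx).trans hf
  have hne : ∀ x ∈ ball (0 : E) 1, 1 - (c : ℂ) * F x ≠ 0 := fun x hx h => by
    have h1 : ‖(c : ℂ) * F x‖ = 1 := by rw [← sub_eq_zero.mp h, norm_one]
    rw [norm_mul, Complex.norm_real, Real.norm_of_nonneg hc0.le] at h1
    nlinarith [hb' x hx]
  have hd : DifferentiableOn ℂ (fun x => (F x - c) / (1 - c * F x)) (ball 0 1) := by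
    simp only [div_eq_mul_inv]
    exact (hF.sub_const _).fun_mul (((hF.const_mul _).const_sub 1).fun_inv hne)
  refine ⟨HInfty.mk _ hd 1 (fun x hx => ?_), HInfty.norm_mk_le zero_le_one, ?_⟩
  · rw [norm_div, div_le_one (norm_pos_iff.mpr (hne x hx)),
      ← sq_le_sq₀ (norm_nonneg _) (norm_nonneg _), Complex.sq_norm, Complex.sq_norm,
      Complex.normSq_apply, Complex.normSq_apply]
    have h1 : (F x).re * (F x).re + (F x).im * (F x).im ≤ 1 := by
      rw [← Complex.normSq_apply, ← Complex.sq_norm]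
      exact pow_le_one₀ (norm_nonneg _) (hb' x hx)
    simp
    nlinarith [mul_nonneg (sub_nonneg.mpr h1) (show 0 ≤ 1 - c ^ 2 by nlinarith)]
  · ext x
    have := hne x x.2
    change (F x - c) / (1 - c * F x) * (1 - c * (f : UnitBall E →ᵇ ℂ) x) =
      (f : UnitBall E →ᵇ ℂ) x - c * 1
    rw [← hFf x, div_mul_cancel₀ _ this, mul_one]

/-- If the unit ball of `H^∞(B_E)` contains functions with `φ f` close to `1`, while the real part
of `χ f` is nonpositive, then `φ` and `χ` have Gleason distance `2`: the Möbius map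
`t ↦ (t - c) / (1 - c t)`, with `c` close to `1`, fixes `1` and sends the left half of the disc
close to `-1`. -/
lemma two_le_gleasonDist_of_re_nonpos {φ χ : MInfty E}
    (h : ∀ ε > 0, ∃ f : HInfty E, ‖f‖ ≤ 1 ∧ ‖φ f - 1‖ ≤ ε ∧ ‖χ f‖ ≤ 1 ∧ (χ f).re ≤ 0) :
    2 ≤ gleasonDist φ χ := by
  refine le_of_forall_pos_le_add fun δ hδ => ?_
  obtain ⟨c, hc0, hc1, hcδ⟩ : ∃ c : ℝ, 0 < c ∧ c < 1 ∧ 4 * (1 - c) ≤ δ :=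
    ⟨max (1 / 2) (1 - δ / 4), by positivity, max_lt (by norm_num) (by linarith), by
      linarith [le_max_right (1 / 2) (1 - δ / 4)]⟩
  obtain ⟨f, hf, hφ, hχ, hre⟩ := h ((1 - c) ^ 2 / 2) (by nlinarith)
  obtain ⟨g, hg, hgf⟩ := HInfty.exists_moebius f hf hc0 hc1
  have hval : ∀ ψ : MInfty E, ψ g * (1 - c * ψ f) = ψ f - c := fun ψ => by
    have := congrArg ψ hgf
    rwa [map_mul, map_sub, map_sub, map_smul, map_smul, map_one, smul_eq_mul, smul_eq_mul,
      mul_one] at this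
  -- On `χ`: `|1 - c χ(f)| ≥ 1`, hence `|χ(g) + 1| ≤ (1 - c) |1 + χ(f)|`.
  have h1 : ‖χ g + 1‖ ≤ 2 * (1 - c) := by
    have e : (χ g + 1) * (1 - c * χ f) = (1 - c : ℝ) * (1 + χ f) := by
      push_cast
      linear_combination hval χ
    have e1 : 1 ≤ ‖1 - c * χ f‖ := by
      refine le_trans ?_ (Complex.re_le_norm _)
      simp
      nlinarith
    have e2 : ‖1 + χ f‖ ≤ 2 := by
      linarith [norm_add_le 1 (χ f), norm_one (α := ℂ)]
    have e3 := congrArg norm e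
    rw [norm_mul, norm_mul, Complex.norm_real, Real.norm_of_nonneg (by linarith)] at e3
    nlinarith [norm_nonneg (χ g + 1)]
  -- On `φ`: `|1 - c φ(f)| ≥ 1 - c - |φ(f) - 1|`, hence `|φ(g) - 1|` is small as well.
  have h2 : ‖φ g - 1‖ ≤ 2 * (1 - c) := by
    have e : (φ g - 1) * (1 - c * φ f) = (1 + c : ℝ) * (φ f - 1) := by
      push_cast
      linear_combination hval φ
    have e1 : (1 - c) / 2 ≤ ‖1 - c * φ f‖ := by
      have t := norm_sub_norm_le ((1 - c : ℝ) : ℂ) (c * (φ f - 1))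
      rw [norm_mul, Complex.norm_real, Complex.norm_real, Real.norm_of_nonneg hc0.le,
        Real.norm_of_nonneg (by linarith),
        show ((1 - c : ℝ) : ℂ) - c * (φ f - 1) = 1 - c * φ f by push_cast; ring] at t
      nlinarith [mul_le_of_le_one_left (norm_nonneg (φ f - 1)) hc1.le]
    have e3 := congrArg norm e
    rw [norm_mul, norm_mul, Complex.norm_real, Real.norm_of_nonneg (by linarith)] at e3
    have e4 : ‖φ g - 1‖ * ((1 - c) / 2) ≤ 2 * (1 - c) * ((1 - c) / 2) :=
      calc ‖φ g - 1‖ * ((1 - c) / 2) ≤ (1 + c) * ‖φ f - 1‖ :=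
            (mul_le_mul_of_nonneg_left e1 (norm_nonneg _)).trans_eq e3
        _ ≤ 2 * ((1 - c) ^ 2 / 2) := mul_le_mul (by linarith) hφ (norm_nonneg _) zero_le_two
        _ = 2 * (1 - c) * ((1 - c) / 2) := by ring
    exact le_of_mul_le_mul_right e4 (by linarith)
  have h3 := norm_sub_le_gleasonDist φ χ g
  have h4 : gleasonDist φ χ * ‖g‖ ≤ gleasonDist φ χ :=
    mul_le_of_le_one_right (gleasonDist_nonneg _ _) hg
  have h5 : (2 : ℝ) ≤ ‖φ g - χ g‖ + ‖φ g - 1‖ + ‖χ g + 1‖ := by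
    have := norm_add₃_le (a := φ g - χ g) (b := -(φ g - 1)) (c := χ g + 1)
    rw [norm_neg, show φ g - χ g + -(φ g - 1) + (χ g + 1) = 2 by ring] at this
    simpa using this
  linarith

lemma norm_apply_le_one (χ : MInfty E) {f : HInfty E} (hf : ‖f‖ ≤ 1) : ‖χ f‖ ≤ 1 := by
  have h1 : ‖(1 : HInfty E)‖ ≤ 1 :=
    (BoundedContinuousFunction.norm_le zero_le_one).mpr fun _ => norm_one.le
  have h2 := WeakDual.CharacterSpace.norm_le_norm_one χ
  exact (ContinuousLinearMap.le_opNorm (WeakDual.toStrongDual (χ : WeakDual ℂ (HInfty E))) f).trans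
    (mul_le_one₀ (h2.trans h1) (norm_nonneg f) hf)

/-- Gleason parts of characters that are almost separated by `1` and `-1` are disjoint. -/
lemma disjoint_gleasonPart {φ ψ : MInfty E}
    (h : ∀ ε > 0, ∃ f : HInfty E, ‖f‖ ≤ 1 ∧ ‖φ f - 1‖ ≤ ε ∧ ‖ψ f + 1‖ ≤ ε) :
    Disjoint (gleasonPart φ) (gleasonPart ψ) := by
  refine disjoint_left.mpr fun χ (hφ : gleasonDist φ χ < 2) (hψ : gleasonDist ψ χ < 2) => ?_
  -- For arbitrarily small `ε` the same sign of the real part of `χ f` occurs.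
  by_cases hs : ∀ ε > 0, ∃ f : HInfty E, ‖f‖ ≤ 1 ∧ ‖φ f - 1‖ ≤ ε ∧ ‖χ f‖ ≤ 1 ∧ (χ f).re ≤ 0
  · exact hφ.not_ge (two_le_gleasonDist_of_re_nonpos hs)
  · push Not at hs
    obtain ⟨ε₀, hε₀, hs⟩ := hs
    refine hψ.not_ge (two_le_gleasonDist_of_re_nonpos fun ε hε => ?_)
    obtain ⟨f, hf, h1, h2⟩ := h (min ε ε₀) (lt_min hε hε₀)
    have hχ := norm_apply_le_one χ hf
    refine ⟨-f, by rwa [norm_neg], ?_, by rwa [map_neg, norm_neg], ?_⟩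
    · rw [map_neg, ← norm_neg, neg_sub, sub_neg_eq_add, add_comm]
      exact h2.trans (min_le_left _ _)
    · rw [map_neg, Complex.neg_re]
      linarith [hs f hf (h1.trans (min_le_right _ _)) hχ]

end Gleason

/-! ### Peaking functions and interpolation -/

/-- A holomorphic map of the disc into a thin neighbourhood of `[0, 1]` which is almost `0` on
`(-1, 0]` and almost `1` at some point of `(0, 1)`. It is `u / (1 + u)`, where
`u = ε ((1 + t) / (1 - t)) ^ c` takes its values in a narrow sector around the positive
half-axis. -/
lemma exists_peaking {ε : ℝ} (hε : 0 < ε) : ∃ (h : ℂ → ℂ) (r : ℝ),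
    DifferentiableOn ℂ h (ball 0 1) ∧
    (∀ t ∈ ball (0 : ℂ) 1, ‖h t‖ + ‖1 - h t‖ ≤ 1 + ε) ∧
    (∀ s : ℝ, 0 ≤ s → s < 1 → ‖h (-s)‖ ≤ ε) ∧ 0 ≤ r ∧ r < 1 ∧ ‖h r - 1‖ ≤ ε := by
  obtain ⟨c, hc0, hc1, hκ⟩ : ∃ c : ℝ, 0 < c ∧ c ≤ 1 ∧
      1 / (1 + ε) ≤ Real.cos (c * (Real.pi / 2)) := by
    have hcont : Tendsto (fun c : ℝ => Real.cos (c * (Real.pi / 2))) (𝓝[>] 0) (𝓝 1) := by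
      have : Continuous fun c : ℝ => Real.cos (c * (Real.pi / 2)) := by fun_prop
      simpa using (this.tendsto 0).mono_left nhdsWithin_le_nhds
    have h1 : 1 / (1 + ε) < 1 := by
      rw [div_lt_one (by positivity)]
      linarith
    obtain ⟨c, h2, h3⟩ := ((hcont.eventually_const_lt h1).and
      (Ioc_mem_nhdsGT (zero_lt_one (α := ℝ)))).exists
    exact ⟨c, h3.1, h3.2, h2.le⟩
  set κ := Real.cos (c * (Real.pi / 2))
  have hκ0 : 0 < κ := lt_of_lt_of_le (by positivity) hκ
  have hκ1 : κ ≤ 1 := Real.cos_le_one _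
  let q : ℂ → ℂ := fun t => (1 + t) / (1 - t)
  let u : ℂ → ℂ := fun t => ε * Complex.exp (c * Complex.log (q t))
  have hne : ∀ t ∈ ball (0 : ℂ) 1, 1 - t ≠ 0 := fun t ht h => by
    rw [← sub_eq_zero.mp h] at ht
    simp at ht
  have hq : ∀ t ∈ ball (0 : ℂ) 1, 0 < (q t).re := fun t ht => by
    have hn : 0 < Complex.normSq (1 - t) := Complex.normSq_pos.mpr (hne t ht)
    have ht' : ‖t‖ ^ 2 < 1 := by
      have := mem_ball_zero_iff.mp ht
      nlinarith [norm_nonneg t]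
    rw [Complex.sq_norm, Complex.normSq_apply] at ht'
    simp only [q, Complex.div_re, ← add_div]
    refine div_pos ?_ hn
    simp
    nlinarith
  have hnorm : ∀ t, ‖u t‖ = ε * Real.exp (c * Real.log ‖q t‖) := fun t => by
    simp [u, Complex.norm_exp, Complex.log_re, abs_of_pos hε]
  have hre : ∀ t ∈ ball (0 : ℂ) 1, κ * ‖u t‖ ≤ (u t).re := fun t ht => by
    have harg : |(q t).arg| < Real.pi / 2 :=
      Complex.abs_arg_lt_pi_div_two_iff.mpr (Or.inl (hq t ht))
    have hcos : κ ≤ Real.cos (c * (q t).arg) := by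
      rw [← Real.cos_abs (c * (q t).arg), abs_mul, abs_of_pos hc0]
      refine Real.cos_le_cos_of_nonneg_of_le_pi (by positivity) ?_
        (mul_le_mul_of_nonneg_left harg.le hc0.le)
      nlinarith [Real.pi_pos]
    have : (u t).re = ‖u t‖ * Real.cos (c * (q t).arg) := by
      rw [hnorm]
      simp [u, Complex.exp_re, Complex.log_re, Complex.log_im, mul_assoc]
    rw [this, mul_comm]
    exact mul_le_mul_of_nonneg_left hcos (norm_nonneg _)
  have hden : ∀ t ∈ ball (0 : ℂ) 1, 1 + κ * ‖u t‖ ≤ ‖1 + u t‖ := fun t ht => by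
    refine le_trans ?_ (Complex.re_le_norm _)
    simpa using hre t ht
  have hpos : ∀ t ∈ ball (0 : ℂ) 1, 1 ≤ ‖1 + u t‖ := fun t ht =>
    le_trans (by linarith [mul_nonneg hκ0.le (norm_nonneg (u t))]) (hden t ht)
  have hden0 : ∀ t ∈ ball (0 : ℂ) 1, 1 + u t ≠ 0 := fun t ht =>
    norm_pos_iff.mp (zero_lt_one.trans_le (hpos t ht))
  have hone : ∀ t ∈ ball (0 : ℂ) 1, 1 - u t / (1 + u t) = 1 / (1 + u t) := fun t ht => by
    have := hden0 t ht
    field_simp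
    ring
  -- The point `r` is chosen so that `(1 + r) / (1 - r) = exp L`, which makes `u r` large.
  set L := (1 + ε) / ε ^ 2 / c with hL
  have hLpos : 0 < L := by positivity
  set M := Real.exp L with hM
  have hM1 : 1 < M := Real.one_lt_exp_iff.mpr hLpos
  have hr1 : (M - 1) / (M + 1) < 1 := by
    rw [div_lt_one (by linarith)]
    linarith
  have hr0 : 0 ≤ (M - 1) / (M + 1) := div_nonneg (by linarith) (by linarith)
  have hrb : (((M - 1) / (M + 1) : ℝ) : ℂ) ∈ ball (0 : ℂ) 1 := by
    rw [mem_ball_zero_iff, Complex.norm_real, Real.norm_of_nonneg hr0]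
    exact hr1
  refine ⟨fun t => u t / (1 + u t), (M - 1) / (M + 1), ?_, fun t ht => ?_, fun s hs0 hs1 => ?_,
    hr0, hr1, ?_⟩
  · have hu : DifferentiableOn ℂ u (ball 0 1) := by
      have hqd : DifferentiableOn ℂ q (ball 0 1) := fun t ht =>
        (DifferentiableAt.div (by fun_prop) (by fun_prop) (hne t ht)).differentiableWithinAt
      exact (((hqd.clog fun t ht => Or.inl (hq t ht)).const_mul _).cexp).const_mul _
    exact hu.div (hu.const_add 1) hden0
  · rw [hone t ht, norm_div, norm_div, norm_one, ← add_div,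
      div_le_iff₀ (zero_lt_one.trans_le (hpos t ht))]
    have h1 : κ * (1 + ‖u t‖) ≤ ‖1 + u t‖ := le_trans (by linarith) (hden t ht)
    have h2 : 1 ≤ (1 + ε) * κ := by
      rwa [div_le_iff₀ (by positivity), mul_comm] at hκ
    nlinarith [norm_nonneg (u t)]
  · have hsb : (-s : ℂ) ∈ ball (0 : ℂ) 1 := by
      rw [mem_ball_zero_iff, norm_neg, Complex.norm_real, Real.norm_of_nonneg hs0]
      exact hs1
    have hqs : ‖q (-s)‖ ≤ 1 := by
      have : q (-s) = ((1 - s) / (1 + s) : ℝ) := by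
        simp only [q]
        push_cast
        ring
      rw [this, Complex.norm_real, Real.norm_of_nonneg (div_nonneg (by linarith) (by linarith)),
        div_le_one (by linarith)]
      linarith
    rw [norm_div]
    refine (div_le_self (norm_nonneg _) (hpos _ hsb)).trans ?_
    rw [hnorm]
    refine mul_le_of_le_one_right hε.le (Real.exp_le_one_iff.mpr ?_)
    exact mul_nonpos_of_nonneg_of_nonpos hc0.le (Real.log_nonpos (norm_nonneg _) hqs)
  · rw [norm_sub_rev, hone _ hrb, norm_div, norm_one,
      div_le_iff₀ (zero_lt_one.trans_le (hpos _ hrb))]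
    have hqr : ‖q ((M - 1) / (M + 1) : ℝ)‖ = M := by
      have hM1' : (M : ℂ) + 1 ≠ 0 := by
        exact_mod_cast (by linarith : M + 1 ≠ 0)
      have : q ((M - 1) / (M + 1) : ℝ) = M := by
        simp only [q]
        push_cast
        field_simp
        ring
      rw [this, Complex.norm_real, Real.norm_of_nonneg (by linarith)]
    have hu : (1 + ε) / ε ≤ ‖u ((M - 1) / (M + 1) : ℝ)‖ := by
      rw [hnorm, hqr, hM, Real.log_exp]
      have h1 : c * L = (1 + ε) / ε ^ 2 := by
        rw [hL]
        field_simp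
      calc (1 + ε) / ε = ε * (c * L) := by
            rw [h1]
            field_simp
        _ ≤ ε * Real.exp (c * L) :=
            mul_le_mul_of_nonneg_left (by linarith [Real.add_one_le_exp (c * L)]) hε.le
    have h3 : 1 / ε ≤ κ * ‖u ((M - 1) / (M + 1) : ℝ)‖ :=
      calc 1 / ε = 1 / (1 + ε) * ((1 + ε) / ε) := by field_simp
        _ ≤ _ := mul_le_mul hκ hu (by positivity) hκ0.le
    calc 1 = ε * (1 / ε) := by field_simp
      _ ≤ _ := mul_le_mul_of_nonneg_left (by linarith [hden _ hrb]) hε.le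

/-- Given functions `H k` with `|H k| + |1 - H k| ≤ 1 + 2⁻ᵏ` on the unit ball, the products
`H k * ∏ j ∈ [K, k), (1 - H j)`, `k ≥ K`, have absolute values that sum up to at most `1 + ε` if
`K` is large. Consequently, where `H n` is almost `1` and the earlier `H j` are almost `0`, the
`n`-th product is close to `1` and all the other ones together are small. -/
lemma exists_interpolating {E : Type*} [NormedAddCommGroup E] [NormedSpace ℂ E] {H : ℕ → E → ℂ}
    (hd : ∀ k, DifferentiableOn ℂ (H k) (ball 0 1))
    (hH : ∀ k, ∀ x ∈ ball (0 : E) 1, ‖H k x‖ + ‖1 - H k x‖ ≤ 1 + (1 / 2) ^ k)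
    {ε : ℝ} (hε : 0 < ε) :
    ∃ K : ℕ, ∀ g : ℕ → E → ℂ, (∀ k, DifferentiableOn ℂ (g k) (ball 0 1)) →
      (∀ k, ∀ x ∈ ball (0 : E) 1, ‖g k x‖ ≤ 1) →
      ∃ f : HInfty E, ‖f‖ ≤ 1 ∧ ∀ n ≥ K, ∀ x : UnitBall E,
        (∀ j < n, ‖H j x‖ ≤ (1 / 2) ^ j) → ‖H n x - 1‖ ≤ (1 / 2) ^ n →
          ‖(f : UnitBall E →ᵇ ℂ) x - g n x‖ ≤ ε := by
  obtain ⟨δ, hδ0, hδ1, hδε⟩ : ∃ δ : ℝ, 0 < δ ∧ δ ≤ 1 ∧ 8 * δ ≤ ε :=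
    ⟨min 1 (ε / 8), by positivity, min_le_left _ _, by linarith [min_le_right 1 (ε / 8)]⟩
  obtain ⟨K, hK1, hK2⟩ : ∃ K : ℕ, Real.exp (2 * (1 / 2) ^ K) ≤ 1 + δ ∧ (1 / 2 : ℝ) ^ K ≤ δ := by
    have h1 : Tendsto (fun K : ℕ => (1 / 2 : ℝ) ^ K) atTop (𝓝 0) :=
      tendsto_pow_atTop_nhds_zero_of_lt_one (by norm_num) (by norm_num)
    have h2 : Tendsto (fun K : ℕ => Real.exp (2 * (1 / 2 : ℝ) ^ K)) atTop (𝓝 1) := by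
      simpa [Function.comp_def] using (Real.continuous_exp.tendsto _).comp (h1.const_mul 2)
    obtain ⟨K, hK⟩ := ((h2.eventually_le_const (by linarith : 1 < 1 + δ)).and
      (h1.eventually_le_const hδ0)).exists
    exact ⟨K, hK⟩
  have hexp : ∀ M, Real.exp (∑ j ∈ Finset.range M, (1 / 2 : ℝ) ^ (K + j)) ≤ 1 + δ := fun M => by
    refine (Real.exp_le_exp.mpr ?_).trans hK1
    simp_rw [pow_add, ← Finset.mul_sum]
    rw [mul_comm]
    refine mul_le_mul_of_nonneg_right ?_ (by positivity)
    exact (Summable.sum_le_tsum _ (fun _ _ => by positivity) summable_geometric_two).trans_eq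
      tsum_geometric_two
  refine ⟨K, fun g hg hgb => ?_⟩
  let P : ℕ → E → ℂ := fun M x => ∏ j ∈ Finset.range M, (1 - H (K + j) x)
  let F : ℕ → E → ℂ := fun k x => H (K + k) x * P k x
  have hFsum : ∀ x ∈ ball (0 : E) 1, ∀ M, ∑ k ∈ Finset.range M, ‖F k x‖ + ‖P M x‖ ≤ 1 + δ := by
    intro x hx M
    refine le_trans ?_ (hexp M)
    induction M with
    | zero => simp [P]
    | succ M ih =>
      rw [Finset.sum_range_succ, Finset.sum_range_succ, Real.exp_add]
      have h1 : P (M + 1) x = P M x * (1 - H (K + M) x) := Finset.prod_range_succ _ _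
      have h2 := hH (K + M) x hx
      rw [h1]
      simp only [F, norm_mul]
      have h3 : 1 + (1 / 2 : ℝ) ^ (K + M) ≤ Real.exp ((1 / 2) ^ (K + M)) := by
        linarith [Real.add_one_le_exp ((1 / 2 : ℝ) ^ (K + M))]
      have h4 : 0 ≤ ∑ k ∈ Finset.range M, ‖F k x‖ := Finset.sum_nonneg fun _ _ => norm_nonneg _
      simp only [F, norm_mul] at ih h4
      refine le_trans ?_ (mul_le_mul ih h3 (by positivity) (Real.exp_nonneg _))
      nlinarith [mul_le_mul_of_nonneg_left h2 (norm_nonneg (P M x)),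
        mul_nonneg h4 (show (0 : ℝ) ≤ (1 / 2) ^ (K + M) by positivity)]
  have hFle : ∀ x ∈ ball (0 : E) 1, ∀ M, ∑ k ∈ Finset.range M, ‖F k x‖ ≤ 1 + δ := fun x hx M => by
    linarith [hFsum x hx M, norm_nonneg (P M x)]
  have hgle : ∀ x ∈ ball (0 : E) 1, ∀ k, ‖F k x * g (K + k) x‖ ≤ ‖F k x‖ := fun x hx k => by
    rw [norm_mul]
    exact mul_le_of_le_one_right (norm_nonneg _) (hgb _ x hx)
  let S : ℕ → E → ℂ := fun M x => ∑ k ∈ Finset.range M, F k x * g (K + k) x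
  have hPd : ∀ M, DifferentiableOn ℂ (P M) (ball 0 1) := fun M => by
    induction M with
    | zero => simp [P]
    | succ M ih =>
      simp only [P, Finset.prod_range_succ]
      exact ih.fun_mul ((hd _).const_sub 1)
  have hSd : ∀ M, DifferentiableOn ℂ (S M) (ball 0 1) := fun M =>
    DifferentiableOn.fun_sum fun k _ => ((hd _).fun_mul (hPd k)).fun_mul (hg _)
  have hSle : ∀ M, ∀ x ∈ ball (0 : E) 1, ‖S M x‖ ≤ 1 + δ := fun M x hx =>
    (norm_sum_le _ _).trans ((Finset.sum_le_sum fun k _ => hgle x hx k).trans (hFle x hx M))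
  have hSlim : ∀ x ∈ ball (0 : E) 1,
      Tendsto (fun M => S M x) atTop (𝓝 (∑' k, F k x * g (K + k) x)) := fun x hx =>
    ((summable_of_sum_range_le (fun k => norm_nonneg (F k x)) (hFle x hx)).of_norm_bounded
      (hgle x hx)).hasSum.tendsto_sum_nat
  have hTd := differentiableOn_ball_of_tendsto hSd hSle hSlim
  have hTle : ∀ x ∈ ball (0 : E) 1, ‖∑' k, F k x * g (K + k) x‖ ≤ 1 + δ := fun x hx =>
    le_of_tendsto (hSlim x hx).norm (Eventually.of_forall fun M => hSle M x hx)
  have hδC : ‖((1 + δ : ℝ) : ℂ)⁻¹‖ = (1 + δ)⁻¹ := by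
    rw [norm_inv, Complex.norm_real, Real.norm_of_nonneg (by linarith)]
  refine ⟨HInfty.mk _ (hTd.const_mul ((1 + δ : ℝ) : ℂ)⁻¹) 1 (fun x hx => ?_),
    HInfty.norm_mk_le zero_le_one, fun n hn x hxj hxn => ?_⟩
  · rw [norm_mul, hδC, inv_mul_le_iff₀ (by linarith), mul_one]
    exact hTle x hx
  rw [HInfty.mk_apply]
  obtain ⟨i, rfl⟩ := Nat.exists_eq_add_of_le hn
  have hx := x.2
  have hP : ‖P i x - 1‖ ≤ δ := by
    have h1 := Finset.norm_prod_one_add_sub_one_le (Finset.range i) fun j => -H (K + j) (x : E)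
    simp only [← sub_eq_add_neg, norm_neg] at h1
    refine h1.trans ?_
    have h2 : ∑ j ∈ Finset.range i, ‖H (K + j) x‖ ≤
        ∑ j ∈ Finset.range i, (1 / 2 : ℝ) ^ (K + j) :=
      Finset.sum_le_sum fun j hj => hxj _ (by simpa using Finset.mem_range.mp hj)
    linarith [hexp i, Real.exp_le_exp.mpr h2]
  have hF1 : ‖F i x - 1‖ ≤ 3 * δ := by
    have h1 : F i x - 1 = (H (K + i) x - 1) * P i x + (P i x - 1) := by
      simp only [F]
      ring
    have h2 : ‖P i x‖ ≤ 2 := by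
      linarith [hFsum x hx i,
        Finset.sum_nonneg fun k (_ : k ∈ Finset.range i) => norm_nonneg (F k x)]
    have h3 : ‖H (K + i) x - 1‖ ≤ δ := hxn.trans (le_trans
      (pow_le_pow_of_le_one (by norm_num) (by norm_num) (Nat.le_add_right K i)) hK2)
    rw [h1]
    refine (norm_add_le _ _).trans ?_
    rw [norm_mul]
    nlinarith [norm_nonneg (P i x), norm_nonneg (H (K + i) x - 1)]
  -- The terms other than the `i`-th one are controlled by the total mass `1 + δ`.
  have hT : ‖∑' k, F k x * g (K + k) x - g (K + i) x‖ ≤ 7 * δ := by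
    refine le_of_tendsto ((hSlim x hx).sub_const _).norm ?_
    filter_upwards [eventually_gt_atTop i] with M hM
    have hi : i ∈ Finset.range M := Finset.mem_range.mpr hM
    have h1 : S M x - g (K + i) x = (F i x - 1) * g (K + i) x +
        ∑ k ∈ (Finset.range M).erase i, F k x * g (K + k) x := by
      simp only [S]
      rw [← Finset.add_sum_erase _ _ hi]
      ring
    have h2 := Finset.add_sum_erase (Finset.range M) (fun k => ‖F k x‖) hi
    have h3 : ‖∑ k ∈ (Finset.range M).erase i, F k x * g (K + k) x‖ ≤
        ∑ k ∈ (Finset.range M).erase i, ‖F k x‖ :=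
      (norm_sum_le _ _).trans (Finset.sum_le_sum fun k _ => hgle x hx k)
    have h4 : ‖(F i x - 1) * g (K + i) x‖ ≤ ‖F i x - 1‖ := by
      rw [norm_mul]
      exact mul_le_of_le_one_right (norm_nonneg _) (hgb _ x hx)
    have h5 : 1 - ‖F i x‖ ≤ ‖F i x - 1‖ := by
      have := norm_sub_norm_le (1 : ℂ) (F i x)
      rwa [norm_one, norm_sub_rev] at this
    rw [h1]
    refine (norm_add_le _ _).trans ?_
    linarith [hFle x hx M]
  set T := ∑' k, F k x * g (K + k) x
  have hscale : ‖((1 + δ : ℝ) : ℂ)⁻¹ * T - T‖ ≤ δ := by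
    have hne : ((1 + δ : ℝ) : ℂ) ≠ 0 := by exact_mod_cast (by linarith : 1 + δ ≠ 0)
    have h1 : ((1 + δ : ℝ) : ℂ)⁻¹ * T - T = ((1 + δ : ℝ) : ℂ)⁻¹ * (-(δ : ℝ) * T) := by
      field_simp
      push_cast
      ring
    rw [h1, norm_mul, hδC, norm_mul, norm_neg, Complex.norm_real, Real.norm_of_nonneg hδ0.le,
      inv_mul_le_iff₀ (by linarith), mul_comm (1 + δ)]
    exact mul_le_mul_of_nonneg_left (hTle x hx) hδ0.le
  linarith [norm_sub_le_norm_sub_add_norm_sub (((1 + δ : ℝ) : ℂ)⁻¹ * T) T (g (K + i) x)]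

/-! ### Finitely supported sequences and the dual of `c₀` -/

lemma CZero.norm_apply_le (x : CZero) (j : ℕ) : ‖x j‖ ≤ ‖x‖ :=
  BoundedContinuousFunction.norm_coe_le_norm x.toBCF j

/-- The `j`-th coordinate functional on `c₀`. -/
def czeroEval (j : ℕ) : CZero →L[ℂ] ℂ :=
  LinearMap.mkContinuous
    { toFun := fun x => x j
      map_add' := fun _ _ => rfl
      map_smul' := fun _ _ => rfl }
    1 fun x => by simpa using x.norm_apply_le j

lemma czeroEval_apply (j : ℕ) (x : CZero) : czeroEval j x = x j := rfl

/-- The finitely supported sequence `(a 0, …, a (N - 1), 0, 0, …)`. -/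
def finSeq (N : ℕ) (a : ℕ → ℂ) : CZero := ∑ j ∈ Finset.range N, a j • unitVec j

lemma unitVec_apply (j i : ℕ) : unitVec j i = if i = j then 1 else 0 :=
  Pi.single_apply j (1 : ℂ) i

lemma finSeq_apply (N : ℕ) (a : ℕ → ℂ) (i : ℕ) : finSeq N a i = if i < N then a i else 0 := by
  have h : finSeq N a i = ∑ j ∈ Finset.range N, a j * unitVec j i := by
    simp only [finSeq, ← czeroEval_apply i, map_sum, map_smul, smul_eq_mul]
  simp [h, unitVec_apply]

lemma map_finSeq (l : StrongDual ℂ CZero) (N : ℕ) (a : ℕ → ℂ) :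
    l (finSeq N a) = ∑ j ∈ Finset.range N, a j * l (unitVec j) := by
  simp [finSeq]

lemma norm_finSeq_le {N : ℕ} {a : ℕ → ℂ} {C : ℝ} (hC : 0 ≤ C) (h : ∀ j < N, ‖a j‖ ≤ C) :
    ‖finSeq N a‖ ≤ C := by
  refine (BoundedContinuousFunction.norm_le (f := (finSeq N a).toBCF) hC).mpr fun i => ?_
  change ‖finSeq N a i‖ ≤ C
  rw [finSeq_apply]
  split_ifs with hi
  · exact h i hi
  · simpa using hC

/-- A unimodular number `ζ` with `conj ζ * t = -|t|`, that is, pointing away from `t`. -/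
lemma exists_unimodular_conj_mul_eq (t : ℂ) :
    ∃ ζ : ℂ, ‖ζ‖ = 1 ∧ (starRingEnd ℂ) ζ * t = -(‖t‖ : ℂ) := by
  rcases eq_or_ne t 0 with rfl | ht
  · exact ⟨1, by simp⟩
  · have h : (‖t‖ : ℂ) ≠ 0 := by simpa using ht
    refine ⟨-t / ‖t‖, by simp [ht], ?_⟩
    rw [map_div₀, map_neg, Complex.conj_ofReal, div_mul_eq_mul_div, neg_mul,
      mul_comm ((starRingEnd ℂ) t), Complex.mul_conj, Complex.normSq_eq_norm_sq]
    field_simp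
    push_cast
    ring

/-- The dual of `c₀` is contained in `ℓ₁`. -/
lemma summable_norm_dual (l : StrongDual ℂ CZero) : Summable fun n => ‖l (unitVec n)‖ := by
  choose ζ hζ hζl using fun n => exists_unimodular_conj_mul_eq (l (unitVec n))
  refine summable_of_sum_range_le (c := ‖l‖) (fun n => norm_nonneg _) fun N => ?_
  have h1 : l (finSeq N fun j => (starRingEnd ℂ) (ζ j)) =
      -((∑ j ∈ Finset.range N, ‖l (unitVec j)‖ : ℝ) : ℂ) := by
    simp [map_finSeq, hζl]
  have h2 := l.le_opNorm (finSeq N fun j => (starRingEnd ℂ) (ζ j))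
  rw [h1, norm_neg, Complex.norm_real, Real.norm_of_nonneg (by positivity)] at h2
  exact h2.trans (mul_le_of_le_one_right (norm_nonneg _)
    (norm_finSeq_le zero_le_one fun j _ => by simp [hζ]))

/-! ### The approximating points -/

/-- The coordinates of `probe z p n w`. -/
def probeCoord (z p : ℕ → ℂ) (n : ℕ) (w : EllInfty) (j : ℕ) : ℂ :=
  if j < n then ((n + 1) / (n + 2) : ℝ) * z j else if j = n then p n else w (j - (n + 1))

/-- The point `(s z₀, …, s z_{n-1}, p n, w₀, …, w_{n-1}, 0, 0, …)` of `c₀`, where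
`s = (n + 1) / (n + 2)`. The entry `p n`, close to the unit circle, marks the position after which
a copy of `w` starts. -/
def probe (z p : ℕ → ℂ) (n : ℕ) (w : EllInfty) : CZero := finSeq (2 * n + 1) (probeCoord z p n w)

section Probe

variable {z p : ℕ → ℂ} {n : ℕ}

lemma probe_apply_of_lt (w : EllInfty) {j : ℕ} (hj : j < n) :
    probe z p n w j = ((n + 1) / (n + 2) : ℝ) * z j := by
  rw [probe, finSeq_apply, if_pos (by omega), probeCoord, if_pos hj]

lemma probe_apply_self (w : EllInfty) : probe z p n w n = p n := by
  rw [probe, finSeq_apply, if_pos (by omega), probeCoord, if_neg (lt_irrefl n), if_pos rfl]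

lemma probe_apply_add (w : EllInfty) {i : ℕ} (hi : i < n) : probe z p n w (n + 1 + i) = w i := by
  rw [probe, finSeq_apply, if_pos (by omega), probeCoord, if_neg (by omega), if_neg (by omega),
    Nat.add_sub_cancel_left]

lemma shrink_factor_lt_one (n : ℕ) : ((n + 1) / (n + 2) : ℝ) < 1 := by
  rw [div_lt_one (by positivity)]
  linarith

lemma norm_probeCoord_le (hz : ∀ j, ‖z j‖ ≤ 1) (w : EllInfty) (j : ℕ) :
    ‖probeCoord z p n w j‖ ≤ max (max ((n + 1) / (n + 2) : ℝ) ‖p n‖) ‖w‖ := by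
  unfold probeCoord
  split_ifs
  · rw [norm_mul, Complex.norm_real, Real.norm_of_nonneg (by positivity)]
    exact (mul_le_of_le_one_right (by positivity) (hz j)).trans
      ((le_max_left _ _).trans (le_max_left _ _))
  · exact (le_max_right _ _).trans (le_max_left _ _)
  · exact (lp.norm_apply_le_norm ENNReal.top_ne_zero w _).trans (le_max_right _ _)

lemma probe_mem_ball (hz : ∀ j, ‖z j‖ ≤ 1) (hp : ‖p n‖ < 1) {w : EllInfty}
    (hw : w ∈ ball (0 : EllInfty) 1) : probe z p n w ∈ ball (0 : CZero) 1 := by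
  rw [mem_ball_zero_iff] at hw ⊢
  refine (norm_finSeq_le (C := max (max ((n + 1) / (n + 2) : ℝ) ‖p n‖) ‖w‖) ?_ fun j _ =>
    norm_probeCoord_le hz w j).trans_lt (max_lt (max_lt (shrink_factor_lt_one n) hp) hw)
  exact (norm_nonneg w).trans (le_max_right _ _)

lemma differentiable_probe : Differentiable ℂ (probe z p n) := by
  unfold probe finSeq
  refine Differentiable.fun_sum fun j _ => Differentiable.smul_const ?_ _
  unfold probeCoord
  split_ifs
  · fun_prop
  · fun_prop
  · exact (lp.evalCLM ℂ (fun _ : ℕ => ℂ) ⊤ (j - (n + 1))).differentiable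

/-- The points `probe z p n w` converge weak-* to `z`. -/
lemma tendsto_dual_probe (hz : ∀ j, ‖z j‖ ≤ 1) (hp : ∀ n, ‖p n‖ < 1) {w : EllInfty}
    (hw : w ∈ ball (0 : EllInfty) 1) (l : StrongDual ℂ CZero) :
    Tendsto (fun n => l (probe z p n w)) atTop (𝓝 (∑' j, z j * l (unitVec j))) := by
  have h : ∀ n, l (probe z p n w) = ∑' j, probe z p n w j * l (unitVec j) := fun n => by
    rw [tsum_eq_sum (s := Finset.range (2 * n + 1))]
    · rw [probe, map_finSeq]
      refine Finset.sum_congr rfl fun j hj => ?_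
      rw [finSeq_apply, if_pos (Finset.mem_range.mp hj)]
    · intro j hj
      rw [probe, finSeq_apply, if_neg (by simpa using hj), zero_mul]
  simp only [h]
  refine tendsto_tsum_of_dominated_convergence (summable_norm_dual l) (fun j => ?_)
    (Eventually.of_forall fun n j => ?_)
  · refine Tendsto.mul_const _ ?_
    have hlim : Tendsto (fun n : ℕ => ((n + 1) / (n + 2) : ℝ)) atTop (𝓝 1) := by
      have := tendsto_natCast_div_add_atTop (1 : ℝ)
      refine ((tendsto_add_atTop_iff_nat 1).mpr this).congr fun n => ?_
      push_cast
      ring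
    have hlim' := ((Complex.continuous_ofReal.tendsto 1).comp hlim).mul_const (z j)
    rw [Complex.ofReal_one, one_mul] at hlim'
    refine hlim'.congr' ?_
    filter_upwards [eventually_gt_atTop j] with n hn
    exact (probe_apply_of_lt w hn).symm
  · rw [norm_mul]
    refine mul_le_of_le_one_left (norm_nonneg _) ((CZero.norm_apply_le _ j).trans ?_)
    exact (mem_ball_zero_iff.mp (probe_mem_ball hz (hp n) hw)).le

/-- Marker entries `p n` and functions `H k` of the `k`-th coordinate that detect the marker: `H k`
is almost `1` if the `k`-th coordinate is `p k`, and almost `0` if it is a multiple `s z k`,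
`0 ≤ s < 1`. The marker points away from `z k`, so this is uniform up to the case `|z k| = 1`. -/
lemma exists_marker (hz : ∀ j, ‖z j‖ ≤ 1) : ∃ (p : ℕ → ℂ) (H : ℕ → CZero → ℂ),
    (∀ n, ‖p n‖ < 1) ∧ (∀ k, DifferentiableOn ℂ (H k) (ball 0 1)) ∧
    (∀ k, ∀ x ∈ ball (0 : CZero) 1, ‖H k x‖ + ‖1 - H k x‖ ≤ 1 + (1 / 2) ^ k) ∧
    (∀ n w, ∀ j < n, ‖H j (probe z p n w)‖ ≤ (1 / 2) ^ j) ∧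
    ∀ n w, ‖H n (probe z p n w) - 1‖ ≤ (1 / 2) ^ n := by
  choose ζ hζ hζz using fun n => exists_unimodular_conj_mul_eq (z n)
  choose h r hd hh hneg hr0 hr1 hhr using fun k : ℕ =>
    exists_peaking (ε := (1 / 2 : ℝ) ^ k) (by positivity)
  have hmaps : ∀ k, ∀ x ∈ ball (0 : CZero) 1,
      (starRingEnd ℂ) (ζ k) * x k ∈ ball (0 : ℂ) 1 := fun k x hx => by
    rw [mem_ball_zero_iff, norm_mul, RCLike.norm_conj, hζ, one_mul]
    exact (x.norm_apply_le k).trans_lt (mem_ball_zero_iff.mp hx)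
  refine ⟨fun n => r n * ζ n, fun k x => h k ((starRingEnd ℂ) (ζ k) * x k), fun n => ?_,
    fun k => ?_, fun k x hx => hh k _ (hmaps k x hx), fun n w j hj => ?_, fun n w => ?_⟩
  · rw [norm_mul, hζ, mul_one, Complex.norm_real, Real.norm_of_nonneg (hr0 n)]
    exact hr1 n
  · exact (hd k).comp (((czeroEval k).differentiable.const_mul _).differentiableOn) (hmaps k)
  · have h1 : (starRingEnd ℂ) (ζ j) * probe z (fun n => r n * ζ n) n w j =
        -(((n + 1) / (n + 2) * ‖z j‖ : ℝ) : ℂ) := by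
      rw [probe_apply_of_lt w hj, mul_left_comm, hζz]
      push_cast
      ring
    simp only [h1]
    exact hneg j _ (by positivity) (lt_of_le_of_lt
      (mul_le_of_le_one_right (by positivity) (hz j)) (shrink_factor_lt_one n))
  · have h1 : (starRingEnd ℂ) (ζ n) * (r n * ζ n) = r n := by
      rw [mul_left_comm, mul_comm _ (ζ n), Complex.mul_conj, Complex.normSq_eq_norm_sq, hζ]
      simp
    simp only [probe_apply_self, h1]
    exact hhr n

end Probe

/-! ### Limits along points of the Stone–Čech compactification of `ℕ` -/

/-- The trace on `ℕ` of the neighbourhood filter of a point of `β(ℕ)`. -/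
def traceFilter (η : StoneCech ℕ) : Filter ℕ := comap stoneCechUnit (𝓝 η)

instance traceFilter.instNeBot (η : StoneCech ℕ) : (traceFilter η).NeBot :=
  comap_neBot fun _ ht => denseRange_stoneCechUnit.mem_nhds ht

lemma traceFilter_le_atTop (η : BetaRemainder) : traceFilter η ≤ atTop := by
  rw [← Nat.cofinite_eq_atTop, le_cofinite_iff_compl_singleton_mem]
  intro n
  refine ⟨{stoneCechUnit n}ᶜ, isOpen_compl_singleton.mem_nhds fun h => η.2 ⟨n, h.symm⟩, ?_⟩
  exact fun m hm hmn => hm (congrArg stoneCechUnit hmn)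

lemma exists_mem_traceFilter_compl_mem {η₁ η₂ : StoneCech ℕ} (h : η₁ ≠ η₂) :
    ∃ A : Set ℕ, A ∈ traceFilter η₁ ∧ Aᶜ ∈ traceFilter η₂ := by
  obtain ⟨U, V, hU, hV, h1, h2, hUV⟩ := t2_separation h
  refine ⟨stoneCechUnit ⁻¹' U, preimage_mem_comap (hU.mem_nhds h1),
    mem_of_superset (preimage_mem_comap (hV.mem_nhds h2)) fun n hn hn' => ?_⟩
  exact disjoint_left.mp hUV hn' hn

lemma tendsto_stoneCechExtend {X : Type*} [TopologicalSpace X] [T2Space X] [CompactSpace X]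
    (g : ℕ → X) (η : StoneCech ℕ) :
    Tendsto g (traceFilter η)
      (𝓝 (stoneCechExtend (continuous_of_discreteTopology (f := g)) η)) := by
  have := ((continuous_stoneCechExtend (continuous_of_discreteTopology (f := g))).tendsto η).comp
    (tendsto_comap (f := (stoneCechUnit : ℕ → StoneCech ℕ)))
  rwa [stoneCechExtend_extends] at this

/-! ### The cardinality of the remainder of `β(ℕ)` -/

/-- The Cantor cube with `2^ℵ₀` factors is separable (a case of the Hewitt–Marczewski–Pondiczery
theorem): points depending on `S ⊆ ℕ` through the membership of a finite trace `S ∩ F` in a finite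
family are dense, and there are countably many of them. -/
lemma exists_denseRange_cube : ∃ g : ℕ → (Set ℕ → Bool), DenseRange g := by
  classical
  let G : Finset ℕ × Finset (Finset ℕ) → Set ℕ → Bool := fun a S =>
    decide (a.1.filter (· ∈ S) ∈ a.2)
  have hG : DenseRange G := by
    refine dense_iff_inter_open.mpr fun U hU ⟨y, hy⟩ => ?_
    obtain ⟨I, u, hu, hIU⟩ := isOpen_pi_iff.mp hU y hy
    have hsep : ∀ S T : Set ℕ, ∃ n, S ≠ T → ¬(n ∈ S ↔ n ∈ T) := fun S T => by
      by_cases h : S = T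
      · exact ⟨0, fun h' => absurd h h'⟩
      · by_contra! hn
        exact h (Set.ext fun n => (hn n).2)
    choose d hd using hsep
    let F : Finset ℕ := (I ×ˢ I).image fun q => d q.1 q.2
    refine ⟨_, hIU fun S hS => ?_,
      ⟨F, (I.filter fun T => y T = true).image fun T => F.filter (· ∈ T)⟩, rfl⟩
    have hval : G ⟨F, (I.filter fun T => y T = true).image fun T => F.filter (· ∈ T)⟩ S = y S := by
      simp only [G]
      cases hyS : y S
      · rw [decide_eq_false_iff_not, Finset.mem_image]
        rintro ⟨T, hT, hTS⟩
        rw [Finset.mem_filter] at hT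
        have hne : S ≠ T := fun h => by simp [h, hT.2] at hyS
        refine hd S T hne ?_
        have hmem : d S T ∈ F := Finset.mem_image.mpr ⟨(S, T), Finset.mk_mem_product hS hT.1, rfl⟩
        have := congrArg (d S T ∈ ·) hTS
        simpa [hmem, eq_comm] using this
      · rw [decide_eq_true_iff]
        exact Finset.mem_image_of_mem _ (Finset.mem_filter.mpr ⟨hS, hyS⟩)
    rw [hval]
    exact (hu S hS).2
  obtain ⟨e, he⟩ := exists_surjective_nat (Finset ℕ × Finset (Finset ℕ))
  exact ⟨G ∘ e, by rwa [DenseRange, he.range_comp]⟩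

lemma mk_stoneCech_nat : Cardinal.mk (StoneCech ℕ) = 2 ^ Cardinal.continuum := by
  refine le_antisymm ?_ ?_
  · have hinj : Function.Injective fun η : StoneCech ℕ => {A : Set ℕ | A ∈ traceFilter η} := by
      intro η₁ η₂ h
      by_contra hne
      obtain ⟨A, h1, h2⟩ := exists_mem_traceFilter_compl_mem hne
      have h3 : A ∈ traceFilter η₂ := (Set.ext_iff.mp h A).mp h1
      exact compl_notMem h3 h2
    simpa using Cardinal.mk_le_of_injective hinj
  · obtain ⟨g, hg⟩ := exists_denseRange_cube
    have hc := continuous_stoneCechExtend (continuous_of_discreteTopology (f := g))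
    have hsurj : Function.Surjective
        (stoneCechExtend (continuous_of_discreteTopology (f := g))) := by
      rw [← range_eq_univ, ← (isCompact_range hc).isClosed.closure_eq]
      refine (hg.mono ?_).closure_eq
      rintro _ ⟨n, rfl⟩
      exact ⟨stoneCechUnit n, stoneCechExtend_stoneCechUnit _ n⟩
    simpa using Cardinal.mk_le_of_surjective hsurj

lemma mk_betaRemainder : Cardinal.mk BetaRemainder = 2 ^ Cardinal.continuum := by
  have hlt : Cardinal.aleph0 < Cardinal.mk (StoneCech ℕ) := by
    rw [mk_stoneCech_nat]
    exact Cardinal.aleph0_lt_continuum.trans (Cardinal.cantor _)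
  have : Infinite (StoneCech ℕ) := Cardinal.infinite_iff.mpr hlt.le
  rw [← mk_stoneCech_nat]
  exact Cardinal.mk_compl_of_infinite _ ((countable_range _).le_aleph0.trans_lt hlt)

/-! ### Limits of point evaluations -/

section LimitHom

variable {E : Type*} [NormedAddCommGroup E] [NormedSpace ℂ E]

/-- The weak-* limit, along a point of `β(ℕ)`, of the evaluations at a sequence in the ball. -/
def limitHom (x : ℕ → UnitBall E) (η : StoneCech ℕ) : MInfty E :=
  stoneCechExtend (continuous_of_discreteTopology (f := fun n => evalHom (x n))) η

lemma tendsto_limitHom (x : ℕ → UnitBall E) (η : StoneCech ℕ) (f : HInfty E) :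
    Tendsto (fun n => (f : UnitBall E →ᵇ ℂ) (x n)) (traceFilter η) (𝓝 (limitHom x η f)) :=
  (((WeakDual.eval_continuous f).comp continuous_subtype_val).tendsto (limitHom x η)).comp
    (tendsto_stoneCechExtend (fun n => evalHom (x n)) η)

lemma norm_limitHom_sub_le {x : ℕ → UnitBall E} {η : StoneCech ℕ} {f : HInfty E} {a : ℂ} {ε : ℝ}
    (h : ∀ᶠ n in traceFilter η, ‖(f : UnitBall E →ᵇ ℂ) (x n) - a‖ ≤ ε) :
    ‖limitHom x η f - a‖ ≤ ε :=
  le_of_tendsto ((tendsto_limitHom x η f).sub_const a).norm h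

lemma gleasonDist_le_of_norm_le_one {φ ψ : MInfty E} {C : ℝ} (hC : 0 ≤ C)
    (h : ∀ f : HInfty E, ‖f‖ ≤ 1 → ‖φ f - ψ f‖ ≤ C) : gleasonDist φ ψ ≤ C := by
  refine gleasonDist_le hC fun f => ?_
  rcases eq_or_ne f 0 with rfl | hf
  · simp
  · have hpos : 0 < ‖f‖ := norm_pos_iff.mpr hf
    have h1 : ‖((‖f‖⁻¹ : ℝ) : ℂ)‖ = ‖f‖⁻¹ := by
      rw [Complex.norm_real, Real.norm_of_nonneg (inv_nonneg.mpr hpos.le)]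
    have h2 := h (((‖f‖⁻¹ : ℝ) : ℂ) • f) (by rw [norm_smul, h1, inv_mul_cancel₀ hpos.ne'])
    rwa [map_smul, map_smul, ← smul_sub, norm_smul, h1, inv_mul_le_iff₀ hpos, mul_comm] at h2

end LimitHom

/-! ### The embeddings of the ball of `ℓ_∞` into a fiber -/

section FiberMap

variable {z p : ℕ → ℂ} (hz : ∀ j, ‖z j‖ ≤ 1) (hp : ∀ n, ‖p n‖ < 1)

/-- The point `probe z p n w` of the unit ball of `c₀`. -/
def probePoint (n : ℕ) (w : UnitBall EllInfty) : UnitBall CZero :=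
  ⟨probe z p n w, probe_mem_ball hz (hp n) w.2⟩

/-- The limit of the evaluations at `probe z p n w` as `n` tends to `η`. -/
def fiberMap (η : StoneCech ℕ) (w : UnitBall EllInfty) : MInfty CZero :=
  limitHom (fun n => probePoint hz hp n w) η

lemma fiberMap_mem_fiber {z : EllInfty} (hz : ∀ j, ‖z j‖ ≤ 1) (η : BetaRemainder)
    (w : UnitBall EllInfty) : fiberMap hz hp η w ∈ fiber z := by
  intro l
  have hs : Summable fun n => z n * l (unitVec n) :=
    (summable_norm_dual l).of_norm_bounded fun n => by
      rw [norm_mul]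
      exact mul_le_of_le_one_left (norm_nonneg _) (hz n)
  refine hs.hasSum_iff.mpr ?_
  have h1 := tendsto_limitHom (fun n => probePoint hz hp n w) η (restrictDual l)
  exact tendsto_nhds_unique ((tendsto_dual_probe hz hp w.2 l).mono_left (traceFilter_le_atTop η)) h1

/-- Composition with `fiberMap` is a contraction from `H^∞` of the ball of `c₀` to `H^∞` of the
ball of `ℓ_∞`. -/
lemma exists_comp_fiberMap (η : StoneCech ℕ) (f : HInfty CZero) : ∃ g : HInfty EllInfty,
    ‖g‖ ≤ ‖f‖ ∧ ∀ w, (g : UnitBall EllInfty →ᵇ ℂ) w = fiberMap hz hp η w f := by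
  classical
  obtain ⟨F, hF, hFf, hb⟩ := HInfty.exists_extension f
  have hmaps : ∀ n, MapsTo (probe z p n) (ball 0 1) (ball 0 1) := fun n _ hw =>
    probe_mem_ball hz (hp n) hw
  let G : EllInfty → ℂ := fun w => if hw : w ∈ ball 0 1 then fiberMap hz hp η ⟨w, hw⟩ f else 0
  have hlim : ∀ w ∈ ball (0 : EllInfty) 1,
      Tendsto (fun n => F (probe z p n w)) (traceFilter η) (𝓝 (G w)) := fun w hw => by
    simp only [G, dif_pos hw]
    exact (tendsto_limitHom (fun n => probePoint hz hp n ⟨w, hw⟩) η f).congr fun n =>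
      (hFf (probePoint hz hp n ⟨w, hw⟩)).symm
  have hbound : ∀ n, ∀ w ∈ ball (0 : EllInfty) 1, ‖F (probe z p n w)‖ ≤ ‖f‖ := fun n w hw =>
    hb _ (hmaps n hw)
  have hG := differentiableOn_ball_of_tendsto
    (fun n => hF.comp differentiable_probe.differentiableOn (hmaps n)) hbound hlim
  refine ⟨HInfty.mk G hG ‖f‖ fun w hw => ?_, HInfty.norm_mk_le (norm_nonneg f), fun w => ?_⟩
  · exact le_of_tendsto (hlim w hw).norm (Eventually.of_forall fun n => hbound n w hw)
  · rw [HInfty.mk_apply]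
    exact dif_pos w.2

lemma isAnalyticIntoSpectrum_fiberMap (η : StoneCech ℕ) :
    IsAnalyticIntoSpectrum (fiberMap hz hp η) := by
  intro f
  obtain ⟨g, -, hg⟩ := exists_comp_fiberMap hz hp η f
  obtain ⟨G, hG, hGg⟩ := g.2
  exact ⟨G, hG, fun w => (hGg w).trans (hg w)⟩

lemma gleasonDist_fiberMap_le (η : StoneCech ℕ) (w v : UnitBall EllInfty) :
    gleasonDist (fiberMap hz hp η w) (fiberMap hz hp η v) ≤
      gleasonDist (evalHom w) (evalHom v) := by
  refine gleasonDist_le (gleasonDist_nonneg _ _) fun f => ?_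
  obtain ⟨g, hgf, hg⟩ := exists_comp_fiberMap hz hp η f
  rw [← hg w, ← hg v, ← evalHom_apply, ← evalHom_apply]
  exact (norm_sub_le_gleasonDist _ _ g).trans
    (mul_le_mul_of_nonneg_left hgf (gleasonDist_nonneg _ _))

end FiberMap

/-! ### Approximation by finitely many coordinates -/

/-- Two bounded sequences are uniformly close to sequences obtained by repeating finitely many of
their entries. -/
lemma exists_selector (w v : EllInfty) {δ : ℝ} (hδ : 0 < δ) : ∃ (σ : ℕ → ℕ) (N : ℕ),
    (∀ m, σ m < N) ∧ ∀ m, ‖w (σ m) - w m‖ ≤ δ ∧ ‖v (σ m) - v m‖ ≤ δ := by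
  let e : ℕ → ℂ × ℂ := fun m => (w m, v m)
  have hbdd : Bornology.IsBounded (range e) := by
    refine isBounded_iff_forall_norm_le.mpr ⟨max ‖w‖ ‖v‖, ?_⟩
    rintro _ ⟨m, rfl⟩
    exact max_le_max (lp.norm_apply_le_norm ENNReal.top_ne_zero w m)
      (lp.norm_apply_le_norm ENNReal.top_ne_zero v m)
  obtain ⟨t, hts, htf, hcov⟩ := Metric.finite_approx_of_totallyBounded
    (hbdd.isCompact_closure.totallyBounded.subset subset_closure) δ hδ
  have hk : ∀ y, ∃ k, y ∈ t → e k = y := fun y => by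
    by_cases hy : y ∈ t
    · obtain ⟨k, hk⟩ := hts hy
      exact ⟨k, fun _ => hk⟩
    · exact ⟨0, fun h => absurd h hy⟩
  choose k hk using hk
  have hy : ∀ m, ∃ y ∈ t, e m ∈ ball y δ := fun m => by
    simpa using hcov (mem_range_self m)
  choose y hyt hym using hy
  obtain ⟨N, hN⟩ := (htf.image k).bddAbove
  refine ⟨fun m => k (y m), N + 1,
    fun m => Nat.lt_succ_of_le (hN (mem_image_of_mem k (hyt m))), fun m => ?_⟩
  have h1 : dist (e m) (e (k (y m))) < δ := by
    rw [hk _ (hyt m)]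
    exact hym m
  rw [Prod.dist_eq, max_lt_iff] at h1
  rw [← dist_eq_norm, ← dist_eq_norm, dist_comm, dist_comm (v _)]
  exact ⟨h1.1.le, h1.2.le⟩

/-- The sequence `m ↦ w (σ m)`. -/
def reindex (σ : ℕ → ℕ) (w : EllInfty) : EllInfty :=
  ⟨fun m => w (σ m), memℓp_infty ⟨‖w‖, by
    rintro _ ⟨m, rfl⟩
    exact lp.norm_apply_le_norm ENNReal.top_ne_zero w (σ m)⟩⟩

/-- The contraction `x ↦ (m ↦ x (k + 1 + σ m))` from `c₀` to `ℓ_∞`. -/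
def selectMap (σ : ℕ → ℕ) (k : ℕ) : CZero →L[ℂ] EllInfty :=
  LinearMap.mkContinuous
    { toFun := fun x => ⟨fun m => x (k + 1 + σ m), memℓp_infty ⟨‖x‖, by
        rintro _ ⟨m, rfl⟩
        exact x.norm_apply_le _⟩⟩
      map_add' := fun _ _ => rfl
      map_smul' := fun _ _ => rfl }
    1 fun x => by
      rw [one_mul]
      exact lp.norm_le_of_forall_le (norm_nonneg x) fun m => x.norm_apply_le _

lemma selectMap_mem_ball (σ : ℕ → ℕ) (k : ℕ) {x : CZero} (hx : x ∈ ball (0 : CZero) 1) :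
    selectMap σ k x ∈ ball (0 : EllInfty) 1 := by
  rw [mem_ball_zero_iff] at hx ⊢
  exact (lp.norm_le_of_forall_le (norm_nonneg x) fun m => x.norm_apply_le _).trans_lt hx

lemma selectMap_probe {z p : ℕ → ℂ} {σ : ℕ → ℕ} {n : ℕ} (hσ : ∀ m, σ m < n) (w : EllInfty) :
    selectMap σ n (probe z p n w) = reindex σ w :=
  lp.ext (funext fun m => probe_apply_add w (hσ m))

section Interpolation

variable {z p : ℕ → ℂ} (hz : ∀ j, ‖z j‖ ≤ 1) (hp : ∀ n, ‖p n‖ < 1) {H : ℕ → CZero → ℂ}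
  (hd : ∀ k, DifferentiableOn ℂ (H k) (ball 0 1))
  (hH : ∀ k, ∀ x ∈ ball (0 : CZero) 1, ‖H k x‖ + ‖1 - H k x‖ ≤ 1 + (1 / 2) ^ k)
  (hsmall : ∀ n w, ∀ j < n, ‖H j (probe z p n w)‖ ≤ (1 / 2) ^ j)
  (hone : ∀ n w, ‖H n (probe z p n w) - 1‖ ≤ (1 / 2) ^ n)

include hd hH hsmall hone

/-- A function on the ball of `ℓ_∞` is approximated, at two given points, by functions of finitely
many coordinates, and these can be read off from the entries of `probe z p n w` behind the
marker. -/
lemma gleasonDist_evalHom_le_fiberMap (η : BetaRemainder) (w v : UnitBall EllInfty) :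
    gleasonDist (evalHom w) (evalHom v) ≤
      gleasonDist (fiberMap hz hp η w) (fiberMap hz hp η v) := by
  refine gleasonDist_le_of_norm_le_one (gleasonDist_nonneg _ _) fun F hF1 => ?_
  obtain ⟨F', hF', hFF', hb⟩ := HInfty.exists_extension F
  refine le_of_forall_pos_le_add fun ε hε => ?_
  have hcont : ∀ u : UnitBall EllInfty, ∃ δ > 0, ∀ y, dist y (u : EllInfty) < δ →
      dist (F' y) (F' u) < ε / 4 := fun u =>
    Metric.continuousAt_iff.mp
      ((hF'.differentiableAt (isOpen_ball.mem_nhds u.2)).continuousAt) _ (by positivity)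
  obtain ⟨δ₁, hδ₁, hw⟩ := hcont w
  obtain ⟨δ₂, hδ₂, hv⟩ := hcont v
  obtain ⟨δ, hδ, hδm⟩ := exists_between (lt_min hδ₁ hδ₂)
  obtain ⟨σ, N, hσN, hσ⟩ := exists_selector (w : EllInfty) (v : EllInfty) hδ
  obtain ⟨K, hK⟩ := exists_interpolating hd hH (show 0 < ε / 4 by positivity)
  obtain ⟨f, hf1, hf⟩ := hK (fun k x => F' (selectMap σ k x))
    (fun k => hF'.comp (selectMap σ k).differentiable.differentiableOn
      fun x hx => selectMap_mem_ball σ k hx)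
    (fun k x hx => (hb _ (selectMap_mem_ball σ k hx)).trans hF1)
  have hlim : ∀ u : UnitBall EllInfty,
      ‖fiberMap hz hp η u f - F' (reindex σ u)‖ ≤ ε / 4 := fun u => by
    refine norm_limitHom_sub_le ?_
    filter_upwards [traceFilter_le_atTop η (eventually_ge_atTop K),
      traceFilter_le_atTop η (eventually_ge_atTop N)] with n hnK hnN
    have := hf n hnK (probePoint hz hp n u) (hsmall n u) (hone n u)
    rwa [show F' (selectMap σ n (probePoint hz hp n u)) = F' (reindex σ u) from
      congrArg F' (selectMap_probe (fun m => (hσN m).trans_le hnN) _)] at this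
  have hnear : ∀ u : EllInfty, (∀ m, ‖u (σ m) - u m‖ ≤ δ) → dist (reindex σ u) u ≤ δ :=
    fun u hu => by
      rw [dist_eq_norm]
      exact lp.norm_le_of_forall_le hδ.le hu
  have hw' := hw _ ((hnear w fun m => (hσ m).1).trans_lt (hδm.trans_le (min_le_left _ _)))
  have hv' := hv _ ((hnear v fun m => (hσ m).2).trans_lt (hδm.trans_le (min_le_right _ _)))
  rw [evalHom_apply, evalHom_apply, ← hFF', ← hFF', ← dist_eq_norm]
  have h1 := norm_sub_le_gleasonDist (fiberMap hz hp η w) (fiberMap hz hp η v) f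
  have h2 := mul_le_of_le_one_right
    (gleasonDist_nonneg (fiberMap hz hp η w) (fiberMap hz hp η v)) hf1
  have h3 := hlim w
  have h4 := hlim v
  rw [← dist_eq_norm] at h1 h3 h4
  have t1 := dist_triangle4 (F' w) (F' (reindex σ w)) (fiberMap hz hp η w f)
    (fiberMap hz hp η v f)
  have t2 := dist_triangle4 (F' w) (fiberMap hz hp η v f) (F' (reindex σ v)) (F' v)
  rw [dist_comm] at hw'
  rw [dist_comm] at h3
  linarith

lemma disjoint_gleasonPart_fiberMap {η₁ η₂ : BetaRemainder} (h : η₁ ≠ η₂)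
    (w v : UnitBall EllInfty) :
    Disjoint (gleasonPart (fiberMap hz hp η₁ w)) (gleasonPart (fiberMap hz hp η₂ v)) := by
  classical
  refine disjoint_gleasonPart fun ε hε => ?_
  obtain ⟨A, hA₁, hA₂⟩ := exists_mem_traceFilter_compl_mem (Subtype.coe_injective.ne h)
  obtain ⟨K, hK⟩ := exists_interpolating hd hH hε
  obtain ⟨f, hf1, hf⟩ := hK (fun k _ => if k ∈ A then 1 else -1)
    (fun k => differentiableOn_const _) (fun k x _ => by split_ifs <;> simp)
  refine ⟨f, hf1, norm_limitHom_sub_le ?_, ?_⟩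
  · filter_upwards [hA₁, traceFilter_le_atTop η₁ (eventually_ge_atTop K)] with n hnA hnK
    simpa only [if_pos hnA] using hf n hnK (probePoint hz hp n w) (hsmall n w) (hone n w)
  · rw [← sub_neg_eq_add]
    refine norm_limitHom_sub_le ?_
    filter_upwards [hA₂, traceFilter_le_atTop η₂ (eventually_ge_atTop K)] with n hnA hnK
    simpa only [if_neg hnA] using hf n hnK (probePoint hz hp n v) (hsmall n v) (hone n v)

end Interpolation

end

theorem theorem1p1 (z : EllInfty) (hz : z ∈ closedBall (0 : EllInfty) 1) :
    ∃ Φ : BetaRemainder × UnitBall EllInfty → fiber z,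
      (∀ η : BetaRemainder,
        IsAnalyticIntoSpectrum (fun w : UnitBall EllInfty => (Φ (η, w) : MInfty CZero)) ∧
        IsGleasonIsometry (fun w : UnitBall EllInfty => (Φ (η, w) : MInfty CZero))) ∧
      (∀ η₁ η₂ : BetaRemainder, η₁ ≠ η₂ →
        LieInDifferentGleasonParts
          (Set.range fun w : UnitBall EllInfty => (Φ (η₁, w) : MInfty CZero))
          (Set.range fun w : UnitBall EllInfty => (Φ (η₂, w) : MInfty CZero))) ∧
      (Set.range fun η : BetaRemainder =>
        Set.range fun w : UnitBall EllInfty => (Φ (η, w) : MInfty CZero)).PairwiseDisjoint id ∧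
      Cardinal.mk (Set.range fun η : BetaRemainder =>
        Set.range fun w : UnitBall EllInfty => (Φ (η, w) : MInfty CZero)) =
        2 ^ Cardinal.continuum := by
  have hz' : ∀ j, ‖z j‖ ≤ 1 := fun j =>
    (lp.norm_apply_le_norm ENNReal.top_ne_zero z j).trans (mem_closedBall_zero_iff.mp hz)
  obtain ⟨p, H, hp, hd, hH, hsmall, hone⟩ := exists_marker hz'
  have hiso : ∀ η : BetaRemainder, IsGleasonIsometry (fiberMap hz' hp η) := fun η w v =>
    (gleasonDist_fiberMap_le hz' hp η w v).antisymm
      (gleasonDist_evalHom_le_fiberMap hz' hp hd hH hsmall hone η w v)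
  have hparts : ∀ η₁ η₂ : BetaRemainder, η₁ ≠ η₂ →
      LieInDifferentGleasonParts (range (fiberMap hz' hp η₁)) (range (fiberMap hz' hp η₂)) := by
    intro η₁ η₂ h
    let o : UnitBall EllInfty := ⟨0, mem_ball_self one_pos⟩
    have hsub : ∀ η : BetaRemainder,
        range (fiberMap hz' hp η) ⊆ gleasonPart (fiberMap hz' hp η o) := by
      rintro η _ ⟨w, rfl⟩
      exact (hiso η o w).trans_lt (gleasonDist_evalHom_zero_lt_two w)
    exact ⟨_, _, hsub η₁, hsub η₂, disjoint_gleasonPart_fiberMap hz' hp hd hH hsmall hone h o o⟩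
  have hdisj : ∀ η₁ η₂ : BetaRemainder, η₁ ≠ η₂ →
      Disjoint (range (fiberMap hz' hp η₁)) (range (fiberMap hz' hp η₂)) := by
    intro η₁ η₂ h
    obtain ⟨φ, ψ, h1, h2, h12⟩ := hparts η₁ η₂ h
    exact h12.mono h1 h2
  refine ⟨fun q => ⟨fiberMap hz' hp q.1 q.2, fiberMap_mem_fiber hp hz' q.1 q.2⟩,
    fun η => ⟨isAnalyticIntoSpectrum_fiberMap hz' hp η, hiso η⟩, hparts, ?_, ?_⟩
  · rintro _ ⟨η₁, rfl⟩ _ ⟨η₂, rfl⟩ hne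
    exact hdisj η₁ η₂ fun h => hne (by rw [h])
  · rw [← mk_betaRemainder]
    refine Cardinal.mk_range_eq _ fun η₁ η₂ h => ?_
    by_contra hne
    have h0 := hdisj η₁ η₂ hne
    have h' : range (fiberMap hz' hp η₁) = range (fiberMap hz' hp η₂) := h
    rw [h', disjoint_self] at h0
    have : Nonempty (UnitBall EllInfty) := ⟨⟨0, mem_ball_self one_pos⟩⟩
    exact (range_nonempty _).ne_empty h0
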